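/- Let $p(x,y)\ge 0$ be a jump probability density on $\mathbb R$ which is translation invariant, $p(x,y)=p(0,y-x)$, with $p(0,\cdot)\in C^\infty(\mathbb R)$, $\int p(0,z)\,dz=1$ and $p(0,z)=0$ for $|z|\ge\xi$, for some $\xi>0$. Let $X_t$ be the Brownian motion on $\mathbb R$ with additional jumps at rate $1$, a jump from $x$ landing in $dy$ with probability $p(x,y)\,dy$; thus $X_t-X_0=B_t+\sum_{i=1}^{N_t}Z_i$ with $B_t\sim\mathcal N(0,t)$, $N_t$ Poisson of mean $t$ and $Z_i$ of density $p(0,\cdot)$, all independent. The free evolution is $$T^*_t v(x)=e^t\,\mathbb E\big[v\big(x-(X_t-X_0)\big)\big],$$ that is, $T^*_tv$ is $e^t$ times the density of $X_t$ when $X_0$ has density $v$. Let $\mathcal M_1$ be the set of nonnegative $v\in L^1(\mathbb R)$ with $\int v=1$. For $\delta>0$ let $C^-_\delta$ and $C^+_\delta$ cut mass on the left: $C^-_\delta w=\mathbf 1_{[V^-,\infty)}w$ for $w$ of mass $1$, where $\int_{V^-}^\infty w=e^{-\delta}$, and $C^+_\delta w=\mathbf 1_{[V^+,\infty)}w$ for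 $w$ of mass $e^\delta$, where $\int_{V^+}^\infty w=1$. For an initial datum $v\in\mathcal M_1$ the deterministic barriers are $$\rho^{\delta,-}(\cdot,k\delta)=(T^*_\delta C^-_\delta)^k v,\qquad \rho^{\delta,+}(\cdot,k\delta)=(C^+_\delta T^*_\delta)^k v,\qquad k=1,2,\dots,$$ and $\rho^{\delta,\pm}(\cdot,t)=T^*_{t-k\delta}\,\rho^{\delta,\pm}(\cdot,k\delta)$ for $k\delta<t<(k+1)\delta$. For densities $f,g\ge0$ write $f\preccurlyeq g$ if $\int_r^\infty f\le\int_r^\infty g$ for all $r\in\mathbb R$. **Theorem.** There is an absolute constant $c$ such that for all $p$ as above and all $v\in\mathcal M_1$ the following holds. 1. For every $\delta>0$ and every $t=k\delta$ with $k\ge 1$ an integer, $\rho^{\delta,\pm}(\cdot,t)\in\mathcal M_1$, $$\rho^{\delta,-}(\cdot,t)\preccurlyeq\rho^{\delta,+}(\cdot,t),\qquad \rho^{\delta,-}(\cdot,t)\preccurlyeq\rho^{\delta/2,-}(\cdot,t),\qquad \rho^{\delta/2,+}(\cdot,t)\preccurlyeq\rho^{\delta,+}(\cdot,t).$$ 2.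 There is a function $u(r,t)$, $r\in\mathbb R$, $t>0$, with $u(\cdot,t)\in\mathcal M_1$ for every $t>0$, such that $$\rho^{\delta,-}(\cdot,t)\preccurlyeq u(\cdot,t)\preccurlyeq\rho^{\delta,+}(\cdot,t)\qquad\text{for all }\delta>0\text{ and all }t=k\delta,\ k\ge1,$$ and it is unique: if $w(r,t)$, with $w(\cdot,t)\ge0$ integrable for every $t>0$, has the same property, then for every $t>0$, $w(r,t)=u(r,t)$ for almost every $r$. 3. For every $T>0$, every integer $n\ge0$ and $\delta=2^{-n}T$, $$\int_{\mathbb R}\big|\rho^{\delta,-}(r,T)-\rho^{\delta,+}(r,T)\big|\,dr\le c\,e^T\delta .$$ -/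

import Mathlib

open MeasureTheory ProbabilityTheory Set
open scoped ENNReal NNReal ContDiff

noncomputable section

namespace FreeBoundary

/-- The jump probability density `p(x,y)`: translation invariant, smooth, of finite range `ξ`. -/
structure IsJumpDensity (p : ℝ → ℝ → ℝ) (ξ : ℝ) : Prop where
  translation_invariant : ∀ x y, p x y = p 0 (y - x)
  smooth : ContDiff ℝ ∞ (p 0)
  nonneg : ∀ z, 0 ≤ p 0 z
  range_pos : 0 < ξ
  finite_range : ∀ z, ξ ≤ |z| → p 0 z = 0
  integral_eq_one : ∫ z, p 0 z = 1

/-- The class `𝓜₁`: nonnegative integrable functions on the line with integral one. -/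
structure IsDensity (v : ℝ → ℝ) : Prop where
  nonneg : ∀ x, 0 ≤ v x
  integrable : Integrable v
  integral_eq_one : ∫ x, v x = 1

/-- The measure `f(r) dr`. -/
def densityMeasure (f : ℝ → ℝ) : Measure ℝ :=
  volume.withDensity (fun r => ENNReal.ofReal (f r))

/-- Mass transport order: `∫_r^∞ dμ ≤ ∫_r^∞ dν` for all `r`. -/
def MassTransportLE (μ ν : Measure ℝ) : Prop :=
  ∀ r : ℝ, μ (Ici r) ≤ ν (Ici r)

/-! ### The free evolution -/

/-- The law `p(0,z) dz` of one jump. -/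
def jumpLaw (p : ℝ → ℝ → ℝ) : Measure ℝ :=
  densityMeasure (p 0)

/-- The law of the sum of `n` independent variables of law `μ`. -/
def convPow (μ : Measure ℝ) : ℕ → Measure ℝ
  | 0 => Measure.dirac 0
  | n + 1 => (convPow μ n).conv μ

/-- The law of `X_t - X_0`, where `X` is a Brownian motion on the line with jumps at rate one,
a jump from `x` going to `y` with probability `p(x,y) dy = p(0,y-x) dy`: the Brownian increment is
centred Gaussian of variance `t`, the number of jumps up to time `t` is Poisson of mean `t`, and
the Brownian motion, the number of jumps and the jump sizes are independent. -/
def displacementLaw (p : ℝ → ℝ → ℝ) (t : ℝ) : Measure ℝ :=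
  (gaussianReal 0 t.toNNReal).conv ((poissonMeasure t.toNNReal).bind (convPow (jumpLaw p)))

/-- The free evolution `T*_t v (x) = e^t ∫ v(y) P_y(X_t ∈ dx)/dx dy = e^t E[v(x - (X_t - X_0))]`. -/
def freeEvolution (p : ℝ → ℝ → ℝ) (t : ℝ) (v : ℝ → ℝ) : ℝ → ℝ :=
  fun x => Real.exp t * ∫ z, v (x - z) ∂(displacementLaw p t)

/-! ### The cut operators -/

/-- A point `V` with `∫_V^∞ v = m` (the rightmost one, when there are several). -/
def cutPoint (m : ℝ) (v : ℝ → ℝ) : ℝ :=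
  sSup {V : ℝ | ∫ x in Ici V, v x = m}

/-- Removal of mass on the left, so that the mass `m` is left. -/
def cut (m : ℝ) (v : ℝ → ℝ) : ℝ → ℝ :=
  (Ici (cutPoint m v)).indicator v

/-- The cut point has the defining property as soon as the mass of `v` exceeds `m > 0`. -/
theorem cutPoint_spec {m : ℝ} {v : ℝ → ℝ} (hv : Integrable v) (hm : 0 < m)
    (hmv : m < ∫ x, v x) : ∫ x in Ici (cutPoint m v), v x = m := by
  have heq : (fun V : ℝ => ∫ x in Ici V, v x)
      = fun V => (∫ x in Ici (0 : ℝ), v x) - ∫ x in (0 : ℝ)..V, v x := by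
    funext V
    rw [integral_Ici_eq_integral_Ioi, integral_Ici_eq_integral_Ioi,
      ← intervalIntegral.integral_Ioi_sub_Ioi' hv.integrableOn hv.integrableOn]
    ring
  have hcont : Continuous (fun V : ℝ => ∫ x in Ici V, v x) := by
    rw [heq]
    exact continuous_const.sub (hv.continuous_primitive 0)
  have htop : Filter.Tendsto (fun V : ℝ => ∫ x in Ici V, v x) Filter.atTop (nhds 0) :=
    tendsto_integral_Ici_zero Filter.tendsto_id
  have hbot : Filter.Tendsto (fun V : ℝ => ∫ x in Ici V, v x) Filter.atBot
      (nhds (∫ x, v x)) :=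
    (aecover_Ici Filter.tendsto_id).integral_tendsto_of_countably_generated hv
  have hclosed : IsClosed {V : ℝ | ∫ x in Ici V, v x = m} :=
    isClosed_eq hcont continuous_const
  obtain ⟨a, ha⟩ := ((hbot.eventually (lt_mem_nhds hmv))).exists
  obtain ⟨B, hB⟩ := Filter.eventually_atTop.1 (htop.eventually (gt_mem_nhds hm))
  have hne : {V : ℝ | ∫ x in Ici V, v x = m}.Nonempty := by
    have := mem_range_of_exists_le_of_exists_ge hcont ⟨B, (hB B le_rfl).le⟩ ⟨a, ha.le⟩
    obtain ⟨V, hV⟩ := this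
    exact ⟨V, hV⟩
  have hbdd : BddAbove {V : ℝ | ∫ x in Ici V, v x = m} := by
    refine ⟨B, fun V hV => ?_⟩
    by_contra h
    exact (hB V (not_le.1 h).le).ne hV
  exact hclosed.csSup_mem hne hbdd

/-- `C⁻_δ`, which leaves the mass `e^{-δ}`. -/
def cutMinus (δ : ℝ) (v : ℝ → ℝ) : ℝ → ℝ := cut (Real.exp (-δ)) v

/-- `C⁺_δ`, which takes functions of mass `e^δ` to functions of mass `1`. -/
def cutPlus (v : ℝ → ℝ) : ℝ → ℝ := cut 1 v

/-! ### The deterministic barriers -/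

/-- The lower barrier `ρ^{δ,-}(·,t)` with initial datum `v`: `(T*_δ C⁻_δ)^k v` at the times
`t = kδ`, followed by the free evolution over the time `t - kδ` when `kδ < t < (k+1)δ`. -/
def lowerBarrier (p : ℝ → ℝ → ℝ) (v : ℝ → ℝ) (δ t : ℝ) : ℝ → ℝ :=
  freeEvolution p (t - ⌊t / δ⌋₊ * δ)
    ((fun w => freeEvolution p δ (cutMinus δ w))^[⌊t / δ⌋₊] v)

/-- The upper barrier `ρ^{δ,+}(·,t)` with initial datum `v`: `(C⁺_δ T*_δ)^k v` at the times
`t = kδ`, followed by the free evolution over the time `t - kδ` when `kδ < t < (k+1)δ`. -/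
def upperBarrier (p : ℝ → ℝ → ℝ) (v : ℝ → ℝ) (δ t : ℝ) : ℝ → ℝ :=
  freeEvolution p (t - ⌊t / δ⌋₊ * δ)
    ((fun w => cutPlus (freeEvolution p δ w))^[⌊t / δ⌋₊] v)

/-- `u` lies between all the barriers: for every `δ > 0` and every `t = kδ`, `k ≥ 1`. -/
def SeparatesBarriers (p : ℝ → ℝ → ℝ) (v : ℝ → ℝ) (u : ℝ → ℝ → ℝ) : Prop :=
  ∀ δ : ℝ, 0 < δ → ∀ k : ℕ, 1 ≤ k →
    MassTransportLE (densityMeasure (lowerBarrier p v δ (k * δ)))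
        (densityMeasure (fun r => u r (k * δ))) ∧
      MassTransportLE (densityMeasure (fun r => u r (k * δ)))
        (densityMeasure (upperBarrier p v δ (k * δ)))

end FreeBoundary

end

/-! Write L = T* C⁻ and U = C⁺ T* for one step of each barrier. On tails, a cut to mass m is the
minimum with m (`densityMeasure_cut_Ici`), and T* is e^t times convolution with a semigroup of
probability laws, so both L and U preserve the mass transport order.

Order: Lw lies below T*w and has mass one, hence lies below Uw; iterate. Refinement for U is
similar, since several small steps stay below the uncut evolution. For L, a large cut made at the
outset removes at least what the small cuts would remove later (`lowerStep_refine`).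

Distance: the normalized cut N = e^δ C⁻ satisfies N L = U N, because cuts are homogeneous and T* is
linear. Hence N L^k v = U^k N v. Since N moves a density by at most 2δ in L¹ and U has Lipschitz
constant e^δ there, L^k v and U^k v differ by at most 2δ + 2δ e^{kδ} ≤ 4 e^{kδ} δ.

Separating element: at a fixed time t the steps t/a and t/b have the common refinement t/(ab), so
every lower barrier is below every upper one. The supremum of the lower tails lies in between, and
domination by T*_t v makes it the tail of a density. Uniqueness follows from the L¹ bound with δ =
t/k → 0. -/

namespace FreeBoundary

/-! ### The law of the displacement -/

/-- Randomizing the index of a convolution semigroup turns a sum of independent indices into a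
convolution; for Poisson indices this is the semigroup property of the compound Poisson law. -/
theorem bind_conv_of_add {M : Type*} [AddMonoid M] [MeasurableSpace M] [MeasurableAdd₂ M]
    (m n : Measure ℕ) [SFinite m] [SFinite n] (κ : ℕ → Measure M)
    [∀ a, SFinite (κ a)] [SFinite (n.bind κ)] (hκ : ∀ a b, κ (a + b) = (κ a).conv (κ b)) :
    (m.conv n).bind κ = (m.bind κ).conv (n.bind κ) := by
  have hm : Measurable κ := measurable_of_countable κ
  refine Measure.ext_of_lintegral _ fun f hf => ?_
  rw [Measure.lintegral_bind hm.aemeasurable hf.aemeasurable,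
    Measure.lintegral_conv (measurable_of_countable _), Measure.lintegral_conv hf,
    Measure.lintegral_bind hm.aemeasurable
      (Measurable.lintegral_prod_right' (f := fun q : M × M => f (q.1 + q.2))
        (by fun_prop)).aemeasurable]
  refine lintegral_congr fun a => ?_
  have h1 : ∀ x, ∫⁻ y, f (x + y) ∂(n.bind κ) = ∫⁻ b, ∫⁻ y, f (x + y) ∂(κ b) ∂n := fun x =>
    Measure.lintegral_bind hm.aemeasurable (by fun_prop)
  simp_rw [h1, hκ]
  have hmeas : AEMeasurable (Function.uncurry fun x b => ∫⁻ y, f (x + y) ∂(κ b))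
      ((κ a).prod n) := by
    refine Measurable.aemeasurable (measurable_from_prod_countable_left fun b => ?_)
    exact Measurable.lintegral_prod_right' (ν := κ b) (f := fun q : M × M => f (q.1 + q.2))
      (by fun_prop)
  refine Eq.trans ?_ (lintegral_lintegral_swap hmeas).symm
  exact lintegral_congr fun b => Measure.lintegral_conv (ν := κ b) hf

variable {p : ℝ → ℝ → ℝ} {ξ : ℝ}

theorem IsJumpDensity.isProbabilityMeasure_jumpLaw (hp : IsJumpDensity p ξ) :
    IsProbabilityMeasure (jumpLaw p) := by
  have hi : Integrable (p 0) := by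
    by_contra h
    have := hp.integral_eq_one
    rw [integral_undef h] at this
    exact zero_ne_one this
  constructor
  rw [jumpLaw, densityMeasure, withDensity_apply _ MeasurableSet.univ, setLIntegral_univ,
    ← ofReal_integral_eq_lintegral_ofReal hi (ae_of_all _ hp.nonneg), hp.integral_eq_one,
    ENNReal.ofReal_one]

instance isProbabilityMeasure_convPow (μ : Measure ℝ) [IsProbabilityMeasure μ] (n : ℕ) :
    IsProbabilityMeasure (convPow μ n) := by
  induction n with
  | zero => exact Measure.dirac.isProbabilityMeasure
  | succ n ih => exact Measure.probabilitymeasure_of_probabilitymeasures_conv _ _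

theorem convPow_add (μ : Measure ℝ) [IsProbabilityMeasure μ] (m n : ℕ) :
    convPow μ (m + n) = (convPow μ m).conv (convPow μ n) := by
  induction n with
  | zero => simp [convPow]
  | succ n ih =>
    rw [← add_assoc, convPow, ih, Measure.conv_assoc]
    rfl

theorem isProbabilityMeasure_bind {α β : Type*} [MeasurableSpace α] [MeasurableSpace β]
    (m : Measure α) [IsProbabilityMeasure m] (κ : α → Measure β) (hκ : Measurable κ)
    [∀ a, IsProbabilityMeasure (κ a)] : IsProbabilityMeasure (m.bind κ) := by
  constructor
  rw [Measure.bind_apply MeasurableSet.univ hκ.aemeasurable]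
  simp

theorem IsJumpDensity.isProbabilityMeasure_displacementLaw (hp : IsJumpDensity p ξ) (t : ℝ) :
    IsProbabilityMeasure (displacementLaw p t) := by
  have := hp.isProbabilityMeasure_jumpLaw
  have := isProbabilityMeasure_bind (poissonMeasure t.toNNReal) (convPow (jumpLaw p))
    (measurable_of_countable _)
  exact Measure.probabilitymeasure_of_probabilitymeasures_conv _ _

theorem IsJumpDensity.displacementLaw_add (hp : IsJumpDensity p ξ) {s t : ℝ} (hs : 0 ≤ s)
    (ht : 0 ≤ t) :
    displacementLaw p (s + t) = (displacementLaw p s).conv (displacementLaw p t) := by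
  have := hp.isProbabilityMeasure_jumpLaw
  have hb (u : ℝ≥0) := isProbabilityMeasure_bind (poissonMeasure u) (convPow (jumpLaw p))
    (measurable_of_countable _)
  -- The mean `0` becomes `0 + 0` so that the Gaussian law splits too; afterwards only the order of
  -- the four factors remains to be exchanged.
  rw [displacementLaw, Real.toNNReal_add hs ht, ← poissonMeasure_conv_poissonMeasure,
    bind_conv_of_add _ _ _ (convPow_add _), ← add_zero (0 : ℝ),
    ← gaussianReal_conv_gaussianReal, displacementLaw, displacementLaw,
    Measure.conv_assoc, Measure.conv_assoc]
  congr 1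
  rw [← Measure.conv_assoc, ← Measure.conv_assoc]
  congr 1
  exact Measure.conv_comm _ _

theorem poissonMeasure_zero : poissonMeasure 0 = Measure.dirac 0 := by
  refine Measure.ext_of_singleton fun n => ?_
  rw [poissonMeasure_singleton]
  cases n <;> simp

theorem displacementLaw_zero (p : ℝ → ℝ → ℝ) : displacementLaw p 0 = Measure.dirac 0 := by
  rw [displacementLaw, Real.toNNReal_zero, poissonMeasure_zero, gaussianReal_zero_var,
    Measure.dirac_bind (measurable_of_countable _)]
  simp [convPow]

/-! ### The free evolution -/

theorem densityMeasure_apply_univ {f : ℝ → ℝ} (hf : Integrable f) (h0 : ∀ x, 0 ≤ f x) :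
    densityMeasure f univ = ENNReal.ofReal (∫ x, f x) := by
  rw [densityMeasure, withDensity_apply _ MeasurableSet.univ, setLIntegral_univ,
    ofReal_integral_eq_lintegral_ofReal hf (ae_of_all _ h0)]

theorem densityMeasure_Ici {f : ℝ → ℝ} (hf : Integrable f) (h0 : ∀ x, 0 ≤ f x) (r : ℝ) :
    densityMeasure f (Ici r) = ENNReal.ofReal (∫ x in Ici r, f x) := by
  rw [densityMeasure, withDensity_apply _ measurableSet_Ici,
    ofReal_integral_eq_lintegral_ofReal hf.integrableOn (ae_of_all _ h0)]

theorem isFiniteMeasure_densityMeasure {f : ℝ → ℝ} (hf : Integrable f) :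
    IsFiniteMeasure (densityMeasure f) :=
  isFiniteMeasure_withDensity_ofReal hf.2

theorem freeEvolution_zero (p : ℝ → ℝ → ℝ) (f : ℝ → ℝ) : freeEvolution p 0 f = f := by
  funext x
  simp [freeEvolution, displacementLaw_zero]

theorem freeEvolution_nonneg (p : ℝ → ℝ → ℝ) (t : ℝ) {f : ℝ → ℝ} (h0 : ∀ x, 0 ≤ f x) (x : ℝ) :
    0 ≤ freeEvolution p t f x :=
  mul_nonneg (Real.exp_pos t).le (integral_nonneg fun _ => h0 _)

theorem freeEvolution_const_mul (p : ℝ → ℝ → ℝ) (t c : ℝ) (f : ℝ → ℝ) :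
    freeEvolution p t (fun x => c * f x) = fun x => c * freeEvolution p t f x := by
  funext x
  simp only [freeEvolution]
  rw [integral_const_mul]
  ring

theorem integrable_comp_sub {f : ℝ → ℝ} (hf : Integrable f) (μ : Measure ℝ) [IsFiniteMeasure μ] :
    Integrable (fun q : ℝ × ℝ => f (q.1 - q.2)) (volume.prod μ) := by
  simpa using Integrable.convolution_integrand (ContinuousLinearMap.mul ℝ ℝ)
    (integrable_const (1 : ℝ) : Integrable (fun _ : ℝ => (1 : ℝ)) μ) hf

/-- At the exceptional points `freeEvolution` takes the default value 0 of the integral, so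
pointwise arguments about it hold only almost everywhere. -/
theorem ae_integrable_comp_sub {f : ℝ → ℝ} (hf : Integrable f) (μ : Measure ℝ)
    [IsFiniteMeasure μ] : ∀ᵐ x, Integrable (fun z => f (x - z)) μ :=
  (integrable_comp_sub hf μ).prod_right_ae

theorem IsJumpDensity.integrable_freeEvolution (hp : IsJumpDensity p ξ) (t : ℝ) {f : ℝ → ℝ}
    (hf : Integrable f) : Integrable (freeEvolution p t f) := by
  have := hp.isProbabilityMeasure_displacementLaw t
  exact (integrable_comp_sub hf (displacementLaw p t)).integral_prod_left.const_mul _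

theorem IsJumpDensity.integral_freeEvolution (hp : IsJumpDensity p ξ) (t : ℝ) {f : ℝ → ℝ}
    (hf : Integrable f) : ∫ x, freeEvolution p t f x = Real.exp t * ∫ x, f x := by
  have := hp.isProbabilityMeasure_displacementLaw t
  simp only [freeEvolution]
  rw [integral_const_mul, integral_integral_swap (integrable_comp_sub hf (displacementLaw p t))]
  simp_rw [integral_sub_right_eq_self f]
  simp

theorem IsJumpDensity.integral_abs_freeEvolution_sub_le (hp : IsJumpDensity p ξ) (t : ℝ)
    {f g : ℝ → ℝ} (hf : Integrable f) (hg : Integrable g) :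
    ∫ x, |freeEvolution p t f x - freeEvolution p t g x| ≤ Real.exp t * ∫ x, |f x - g x| := by
  have := hp.isProbabilityMeasure_displacementLaw t
  have hfg : Integrable fun x => |f x - g x| := (hf.sub hg).abs
  rw [← hp.integral_freeEvolution t hfg]
  refine integral_mono_ae ((hp.integrable_freeEvolution t hf).sub
    (hp.integrable_freeEvolution t hg)).abs (hp.integrable_freeEvolution t hfg) ?_
  filter_upwards [ae_integrable_comp_sub hf (displacementLaw p t),
    ae_integrable_comp_sub hg (displacementLaw p t)] with x h1 h2
  simp only [freeEvolution]
  rw [← mul_sub, abs_mul, abs_of_pos (Real.exp_pos t), ← integral_sub h1 h2]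
  exact mul_le_mul_of_nonneg_left abs_integral_le_integral_abs (Real.exp_pos t).le

theorem IsJumpDensity.densityMeasure_freeEvolution (hp : IsJumpDensity p ξ) (t : ℝ) {f : ℝ → ℝ}
    (hf : Integrable f) (h0 : ∀ x, 0 ≤ f x) :
    densityMeasure (freeEvolution p t f) =
      ENNReal.ofReal (Real.exp t) • (densityMeasure f).conv (displacementLaw p t) := by
  have := hp.isProbabilityMeasure_displacementLaw t
  have := isFiniteMeasure_densityMeasure hf
  set μ := displacementLaw p t
  ext s hs
  have hm : AEMeasurable (fun q : ℝ × ℝ => ENNReal.ofReal (f (q.1 - q.2)))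
      ((volume.restrict s).prod μ) :=
    (integrable_comp_sub hf μ).aestronglyMeasurable.aemeasurable.ennreal_ofReal.mono_measure
      (Measure.prod_mono Measure.restrict_le_self le_rfl)
  have hi : Measurable (s.indicator (1 : ℝ → ℝ≥0∞)) := measurable_one.indicator hs
  calc densityMeasure (freeEvolution p t f) s
      = ∫⁻ x in s, ENNReal.ofReal (Real.exp t) * ∫⁻ z, ENNReal.ofReal (f (x - z)) ∂μ := by
        rw [densityMeasure, withDensity_apply _ hs]
        refine lintegral_congr_ae (ae_restrict_of_ae ?_)
        filter_upwards [ae_integrable_comp_sub hf μ] with x hx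
        rw [freeEvolution, ENNReal.ofReal_mul (Real.exp_pos t).le,
          ofReal_integral_eq_lintegral_ofReal hx (ae_of_all _ fun _ => h0 _)]
    _ = ENNReal.ofReal (Real.exp t) * ∫⁻ z, (∫⁻ x in s, ENNReal.ofReal (f (x - z))) ∂μ := by
        rw [lintegral_const_mul' _ _ ENNReal.ofReal_ne_top, lintegral_lintegral_swap hm]
    _ = ENNReal.ofReal (Real.exp t) * ∫⁻ z, ∫⁻ x, s.indicator 1 (z + x)
          ∂(densityMeasure f) ∂μ := by
        congr 1
        refine lintegral_congr fun z => ?_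
        have hc : AEMeasurable (fun x => s.indicator (1 : ℝ → ℝ≥0∞) (z + x)) :=
          (hi.comp (measurable_const_add z)).aemeasurable
        -- For fixed z, the substitution x ↦ x + z moves the translation from f to the set s.
        rw [densityMeasure, lintegral_withDensity_eq_lintegral_mul₀
          hf.aestronglyMeasurable.aemeasurable.ennreal_ofReal
          hc, ← lintegral_indicator hs,
          ← lintegral_add_right_eq_self _ z]
        refine lintegral_congr fun x => ?_
        by_cases h : x + z ∈ s
        · simp [h, add_comm z x]
        · simp [h, add_comm z x]
    _ = _ := by
        rw [← Measure.lintegral_conv hi, lintegral_indicator_one hs, Measure.conv_comm]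
        rfl

/-! ### Mass transport order -/

theorem MassTransportLE.trans {μ ν κ : Measure ℝ} (h : MassTransportLE μ ν)
    (h' : MassTransportLE ν κ) : MassTransportLE μ κ := fun r => (h r).trans (h' r)

theorem MassTransportLE.of_le {μ ν : Measure ℝ} (h : μ ≤ ν) : MassTransportLE μ ν := fun _ => h _

/-- The tail of a convolution is an average over z of translated tails, and each of these is
ordered. -/
theorem MassTransportLE.conv {μ ν : Measure ℝ} [SFinite μ] [SFinite ν] (h : MassTransportLE μ ν)
    (κ : Measure ℝ) [SFinite κ] : MassTransportLE (μ.conv κ) (ν.conv κ) := by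
  intro r
  have key (ρ : Measure ℝ) [SFinite ρ] : (ρ.conv κ) (Ici r) = ∫⁻ z, ρ (Ici (r - z)) ∂κ := by
    rw [Measure.conv_comm, ← lintegral_indicator_one measurableSet_Ici,
      Measure.lintegral_conv (measurable_one.indicator measurableSet_Ici)]
    refine lintegral_congr fun z => ?_
    rw [← lintegral_indicator_one measurableSet_Ici]
    refine lintegral_congr fun x => ?_
    simp only [indicator, mem_Ici, sub_le_iff_le_add']
    rfl
  rw [key, key]
  exact lintegral_mono fun z => h _

/-! ### The free evolution on measures -/

/-- The free evolution of measures. -/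
noncomputable def evolve (p : ℝ → ℝ → ℝ) (t : ℝ) (μ : Measure ℝ) : Measure ℝ :=
  ENNReal.ofReal (Real.exp t) • μ.conv (displacementLaw p t)

theorem IsJumpDensity.evolve_massTransportLE (hp : IsJumpDensity p ξ) (t : ℝ) {μ ν : Measure ℝ}
    [SFinite μ] [SFinite ν] (h : MassTransportLE μ ν) :
    MassTransportLE (evolve p t μ) (evolve p t ν) := by
  have := hp.isProbabilityMeasure_displacementLaw t
  intro r
  simp only [evolve, Measure.smul_apply, smul_eq_mul]
  exact mul_le_mul' le_rfl (h.conv (displacementLaw p t) r)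

theorem IsJumpDensity.evolve_mono (hp : IsJumpDensity p ξ) (t : ℝ) {μ ν : Measure ℝ}
    (h : μ ≤ ν) : evolve p t μ ≤ evolve p t ν := by
  have := hp.isProbabilityMeasure_displacementLaw t
  intro s
  simp only [evolve, Measure.smul_apply, smul_eq_mul]
  exact mul_le_mul' le_rfl
    (Measure.map_mono (Measure.prod_mono h (le_refl (displacementLaw p t))) measurable_add s)

theorem evolve_zero (p : ℝ → ℝ → ℝ) (μ : Measure ℝ) [SFinite μ] : evolve p 0 μ = μ := by
  simp [evolve, displacementLaw_zero]

theorem IsJumpDensity.evolve_univ (hp : IsJumpDensity p ξ) (t : ℝ) (μ : Measure ℝ) [SFinite μ] :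
    evolve p t μ univ = ENNReal.ofReal (Real.exp t) * μ univ := by
  have := hp.isProbabilityMeasure_displacementLaw t
  rw [evolve, Measure.smul_apply, smul_eq_mul, Measure.conv, Measure.map_apply measurable_add
    MeasurableSet.univ, preimage_univ, ← univ_prod_univ, Measure.prod_prod,
    measure_univ (μ := displacementLaw p t), mul_one]

theorem IsJumpDensity.isFiniteMeasure_evolve (hp : IsJumpDensity p ξ) (t : ℝ) (μ : Measure ℝ)
    [IsFiniteMeasure μ] : IsFiniteMeasure (evolve p t μ) := by
  constructor
  rw [hp.evolve_univ]
  exact ENNReal.mul_lt_top ENNReal.ofReal_lt_top (measure_lt_top _ _)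

theorem IsJumpDensity.evolve_evolve (hp : IsJumpDensity p ξ) {s t : ℝ} (hs : 0 ≤ s) (ht : 0 ≤ t)
    (μ : Measure ℝ) [SFinite μ] : evolve p t (evolve p s μ) = evolve p (s + t) μ := by
  have := hp.isProbabilityMeasure_displacementLaw s
  have := hp.isProbabilityMeasure_displacementLaw t
  rw [evolve, evolve, evolve, Measure.conv_smul_left, smul_smul, Measure.conv_assoc,
    ← hp.displacementLaw_add hs ht, Real.exp_add, ENNReal.ofReal_mul (Real.exp_pos s).le,
    mul_comm]

theorem IsJumpDensity.densityMeasure_freeEvolution_eq_evolve (hp : IsJumpDensity p ξ) (t : ℝ)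
    {f : ℝ → ℝ} (hf : Integrable f) (h0 : ∀ x, 0 ≤ f x) :
    densityMeasure (freeEvolution p t f) = evolve p t (densityMeasure f) :=
  hp.densityMeasure_freeEvolution t hf h0

/-! ### The cut operators -/

section cut

variable {m : ℝ} {f g : ℝ → ℝ}

theorem cut_nonneg (m : ℝ) (h0 : ∀ x, 0 ≤ f x) (x : ℝ) : 0 ≤ cut m f x :=
  indicator_nonneg (fun x _ => h0 x) x

theorem integrable_cut (m : ℝ) (hf : Integrable f) : Integrable (cut m f) :=
  hf.indicator measurableSet_Ici

theorem integral_cut (hf : Integrable f) (hm : 0 < m) (hmf : m < ∫ x, f x) :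
    ∫ x, cut m f x = m := by
  rw [cut, integral_indicator measurableSet_Ici, cutPoint_spec hf hm hmf]

theorem densityMeasure_cut (m : ℝ) (f : ℝ → ℝ) :
    densityMeasure (cut m f) = (densityMeasure f).restrict (Ici (cutPoint m f)) := by
  rw [densityMeasure, densityMeasure, restrict_withDensity measurableSet_Ici,
    ← withDensity_indicator measurableSet_Ici]
  congr 1
  funext x
  by_cases h : x ∈ Ici (cutPoint m f) <;> simp [cut, h]

theorem densityMeasure_cut_le (m : ℝ) (f : ℝ → ℝ) :
    densityMeasure (cut m f) ≤ densityMeasure f := by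
  rw [densityMeasure_cut]
  exact Measure.restrict_le_self

/-- To the left of the cut point the tail is constantly m; to its right nothing has changed. All
comparisons of cuts in the transport order reduce to this formula. -/
theorem densityMeasure_cut_Ici (hf : Integrable f) (h0 : ∀ x, 0 ≤ f x) (hm : 0 < m)
    (hmf : m < ∫ x, f x) (r : ℝ) :
    densityMeasure (cut m f) (Ici r) = min (densityMeasure f (Ici r)) (ENNReal.ofReal m) := by
  have hV : densityMeasure f (Ici (cutPoint m f)) = ENNReal.ofReal m := by
    rw [densityMeasure_Ici hf h0, cutPoint_spec hf hm hmf]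
  rw [densityMeasure_cut, Measure.restrict_apply measurableSet_Ici, Ici_inter_Ici, ← hV]
  rcases le_total r (cutPoint m f) with h | h
  · rw [sup_eq_right.2 h, min_eq_right (measure_mono (Ici_subset_Ici.2 h))]
  · rw [sup_eq_left.2 h, min_eq_left (measure_mono (Ici_subset_Ici.2 h))]

/-- Let a ≤ b be the cut points of f and g. The cuts differ by f on [a,b) and by f - g on [b,∞). As
both keep mass m, ∫_[a,b) f equals ∫_[b,∞) (g - f), which by equality of total masses is ∫_(-∞,b) (f
- g). So the discrepancy created by the cuts is paid for by the part of |f - g| left of b. -/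
theorem integral_abs_cut_sub_le (hf : Integrable f) (hg : Integrable g) (h0 : ∀ x, 0 ≤ f x)
    (g0 : ∀ x, 0 ≤ g x) (hfg : ∫ x, f x = ∫ x, g x) (hm : 0 < m) (hmf : m < ∫ x, f x) :
    ∫ x, |cut m f x - cut m g x| ≤ ∫ x, |f x - g x| := by
  wlog h : cutPoint m f ≤ cutPoint m g generalizing f g
  · have := this hg hf g0 h0 hfg.symm (hfg ▸ hmf) (le_of_not_ge h)
    simpa only [abs_sub_comm] using this
  have hF := cutPoint_spec hf hm hmf
  have hG := cutPoint_spec hg hm (hfg ▸ hmf)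
  set a := cutPoint m f
  set b := cutPoint m g
  have hd : Integrable fun x => |f x - g x| := (hf.sub hg).abs
  have e1 : ∫ x, |cut m f x - cut m g x|
      = (∫ x in Ico a b, f x) + ∫ x in Ici b, |f x - g x| := by
    rw [← integral_indicator measurableSet_Ico, ← integral_indicator measurableSet_Ici,
      ← integral_add (hf.indicator measurableSet_Ico) (hd.indicator measurableSet_Ici)]
    congr 1
    funext x
    have ha : cut m f x = (Ici a).indicator f x := rfl
    have hb : cut m g x = (Ici b).indicator g x := rfl
    rw [ha, hb]
    rcases lt_or_ge x a with h1 | h1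
    · simp [indicator, not_le.2 h1, not_le.2 (h1.trans_le h)]
    · rcases lt_or_ge x b with h2 | h2
      · simp [indicator, h1, h2, not_le.2 h2, abs_of_nonneg (h0 x)]
      · simp [indicator, h1, h2, not_lt.2 h2]
  have hu : Ico a b ∪ Ici b = Ici a := Ico_union_Ici_eq_Ici h
  have e2 : (∫ x in Ico a b, f x) + ∫ x in Ici b, f x = m := by
    rw [← setIntegral_union (by
      rw [disjoint_left]; exact fun x hx hx' => not_le.2 hx.2 hx') measurableSet_Ici
      hf.integrableOn hf.integrableOn, hu, hF]
  have c1 := integral_add_compl (measurableSet_Ici (a := b)) hf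
  have c2 := integral_add_compl (measurableSet_Ici (a := b)) hg
  have c3 := integral_add_compl (measurableSet_Ici (a := b)) hd
  have c4 : (∫ x in (Ici b)ᶜ, f x) - ∫ x in (Ici b)ᶜ, g x ≤ ∫ x in (Ici b)ᶜ, |f x - g x| := by
    rw [← integral_sub hf.integrableOn hg.integrableOn]
    exact integral_mono (hf.sub hg).integrableOn hd.integrableOn fun x => le_abs_self _
  rw [e1]
  linarith

theorem cut_const_mul {c : ℝ} (hc : c ≠ 0) (m : ℝ) (f : ℝ → ℝ) :
    cut (c * m) (fun x => c * f x) = fun x => c * cut m f x := by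
  have h : cutPoint (c * m) (fun x => c * f x) = cutPoint m f := by
    simp only [cutPoint, integral_const_mul, mul_right_inj' hc]
  funext x
  rw [cut, cut, h]
  by_cases hx : x ∈ Ici (cutPoint m f) <;> simp [hx]

end cut

/-! ### One step of the barriers -/

/-- One step of the lower barrier. -/
noncomputable def lowerStep (p : ℝ → ℝ → ℝ) (δ : ℝ) (w : ℝ → ℝ) : ℝ → ℝ :=
  freeEvolution p δ (cutMinus δ w)

/-- One step of the upper barrier. -/
noncomputable def upperStep (p : ℝ → ℝ → ℝ) (δ : ℝ) (w : ℝ → ℝ) : ℝ → ℝ :=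
  cutPlus (freeEvolution p δ w)

/-- At a grid time the residual free evolution runs for time 0 and is the identity. -/
theorem lowerBarrier_natCast_mul (p : ℝ → ℝ → ℝ) (v : ℝ → ℝ) {δ : ℝ} (hδ : 0 < δ) (k : ℕ) :
    lowerBarrier p v δ (k * δ) = (lowerStep p δ)^[k] v := by
  rw [lowerBarrier, mul_div_cancel_right₀ _ hδ.ne', Nat.floor_natCast, sub_self,
    freeEvolution_zero]
  rfl

theorem upperBarrier_natCast_mul (p : ℝ → ℝ → ℝ) (v : ℝ → ℝ) {δ : ℝ} (hδ : 0 < δ) (k : ℕ) :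
    upperBarrier p v δ (k * δ) = (upperStep p δ)^[k] v := by
  rw [upperBarrier, mul_div_cancel_right₀ _ hδ.ne', Nat.floor_natCast, sub_self,
    freeEvolution_zero]
  rfl

variable {v w : ℝ → ℝ} {δ : ℝ}

theorem IsDensity.densityMeasure_univ (hw : IsDensity w) : densityMeasure w univ = 1 := by
  rw [densityMeasure_apply_univ hw.integrable hw.nonneg, hw.integral_eq_one, ENNReal.ofReal_one]

theorem IsDensity.isProbabilityMeasure (hw : IsDensity w) :
    IsProbabilityMeasure (densityMeasure w) := ⟨hw.densityMeasure_univ⟩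

theorem IsDensity.exp_neg_lt (hw : IsDensity w) (hδ : 0 < δ) : Real.exp (-δ) < ∫ x, w x := by
  rw [hw.integral_eq_one]
  exact Real.exp_lt_one_iff.2 (neg_lt_zero.2 hδ)

theorem IsDensity.one_lt_integral_freeEvolution (hw : IsDensity w) (hp : IsJumpDensity p ξ)
    (hδ : 0 < δ) : 1 < ∫ x, freeEvolution p δ w x := by
  rw [hp.integral_freeEvolution δ hw.integrable, hw.integral_eq_one, mul_one]
  exact Real.one_lt_exp_iff.2 hδ

theorem IsDensity.lowerStep (hw : IsDensity w) (hp : IsJumpDensity p ξ) (hδ : 0 < δ) :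
    IsDensity (lowerStep p δ w) where
  nonneg := freeEvolution_nonneg p δ (cut_nonneg _ hw.nonneg)
  integrable := hp.integrable_freeEvolution δ (integrable_cut _ hw.integrable)
  integral_eq_one := by
    rw [FreeBoundary.lowerStep, cutMinus,
      hp.integral_freeEvolution δ (integrable_cut _ hw.integrable),
      integral_cut hw.integrable (Real.exp_pos _) (hw.exp_neg_lt hδ), ← Real.exp_add,
      add_neg_cancel, Real.exp_zero]

theorem IsDensity.upperStep (hw : IsDensity w) (hp : IsJumpDensity p ξ) (hδ : 0 < δ) :
    IsDensity (upperStep p δ w) where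
  nonneg := cut_nonneg _ (freeEvolution_nonneg p δ hw.nonneg)
  integrable := integrable_cut _ (hp.integrable_freeEvolution δ hw.integrable)
  integral_eq_one := integral_cut (hp.integrable_freeEvolution δ hw.integrable) one_pos
    (hw.one_lt_integral_freeEvolution hp hδ)

theorem IsDensity.iterate_lowerStep (hv : IsDensity v) (hp : IsJumpDensity p ξ) (hδ : 0 < δ)
    (k : ℕ) : IsDensity ((FreeBoundary.lowerStep p δ)^[k] v) := by
  induction k with
  | zero => exact hv
  | succ k ih =>
    rw [Function.iterate_succ_apply']
    exact ih.lowerStep hp hδ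

theorem IsDensity.iterate_upperStep (hv : IsDensity v) (hp : IsJumpDensity p ξ) (hδ : 0 < δ)
    (k : ℕ) : IsDensity ((FreeBoundary.upperStep p δ)^[k] v) := by
  induction k with
  | zero => exact hv
  | succ k ih =>
    rw [Function.iterate_succ_apply']
    exact ih.upperStep hp hδ

theorem IsDensity.densityMeasure_lowerStep (hw : IsDensity w) (hp : IsJumpDensity p ξ) (δ : ℝ) :
    densityMeasure (FreeBoundary.lowerStep p δ w) =
      evolve p δ (densityMeasure (cutMinus δ w)) :=
  hp.densityMeasure_freeEvolution_eq_evolve δ (integrable_cut _ hw.integrable)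
    (cut_nonneg _ hw.nonneg)

theorem IsDensity.cutMinus_Ici (hw : IsDensity w) (hδ : 0 < δ) (r : ℝ) :
    densityMeasure (cutMinus δ w) (Ici r) =
      min (densityMeasure w (Ici r)) (ENNReal.ofReal (Real.exp (-δ))) :=
  densityMeasure_cut_Ici hw.integrable hw.nonneg (Real.exp_pos _) (hw.exp_neg_lt hδ) r

theorem IsDensity.upperStep_Ici (hw : IsDensity w) (hp : IsJumpDensity p ξ) (hδ : 0 < δ) (r : ℝ) :
    densityMeasure (FreeBoundary.upperStep p δ w) (Ici r) =
      min (evolve p δ (densityMeasure w) (Ici r)) 1 := by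
  rw [FreeBoundary.upperStep, cutPlus,
    densityMeasure_cut_Ici (hp.integrable_freeEvolution δ hw.integrable)
      (freeEvolution_nonneg p δ hw.nonneg) one_pos (hw.one_lt_integral_freeEvolution hp hδ) r,
    hp.densityMeasure_freeEvolution_eq_evolve δ hw.integrable hw.nonneg, ENNReal.ofReal_one]

theorem IsDensity.densityMeasure_Ici_le_one (hw : IsDensity w) (r : ℝ) :
    densityMeasure w (Ici r) ≤ 1 :=
  (measure_mono (subset_univ _)).trans hw.densityMeasure_univ.le

theorem IsDensity.sfinite (hw : IsDensity w) : SFinite (densityMeasure w) :=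
  have := hw.isProbabilityMeasure
  inferInstance

theorem IsDensity.isFiniteMeasure_cut (hw : IsDensity w) (m : ℝ) :
    IsFiniteMeasure (densityMeasure (cut m w)) :=
  isFiniteMeasure_densityMeasure (integrable_cut _ hw.integrable)

/-! ### Order of the barriers -/

theorem lowerStep_mono (hp : IsJumpDensity p ξ) (hδ : 0 < δ) (hv : IsDensity v) (hw : IsDensity w)
    (h : MassTransportLE (densityMeasure v) (densityMeasure w)) :
    MassTransportLE (densityMeasure (lowerStep p δ v)) (densityMeasure (lowerStep p δ w)) := by
  have : IsFiniteMeasure (densityMeasure (cutMinus δ v)) := hv.isFiniteMeasure_cut _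
  have : IsFiniteMeasure (densityMeasure (cutMinus δ w)) := hw.isFiniteMeasure_cut _
  rw [hv.densityMeasure_lowerStep hp, hw.densityMeasure_lowerStep hp]
  refine hp.evolve_massTransportLE δ fun r => ?_
  rw [hv.cutMinus_Ici hδ, hw.cutMinus_Ici hδ]
  exact min_le_min_right _ (h r)

theorem upperStep_mono (hp : IsJumpDensity p ξ) (hδ : 0 < δ) (hv : IsDensity v) (hw : IsDensity w)
    (h : MassTransportLE (densityMeasure v) (densityMeasure w)) :
    MassTransportLE (densityMeasure (upperStep p δ v)) (densityMeasure (upperStep p δ w)) := by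
  have := hv.sfinite
  have := hw.sfinite
  intro r
  rw [hv.upperStep_Ici hp hδ, hw.upperStep_Ici hp hδ]
  exact min_le_min_right _ (hp.evolve_massTransportLE δ h r)

theorem lowerStep_le_upperStep (hp : IsJumpDensity p ξ) (hδ : 0 < δ) (hw : IsDensity w) :
    MassTransportLE (densityMeasure (lowerStep p δ w)) (densityMeasure (upperStep p δ w)) := by
  intro r
  rw [hw.upperStep_Ici hp hδ]
  refine le_min ?_ ((hw.lowerStep hp hδ).densityMeasure_Ici_le_one r)
  rw [hw.densityMeasure_lowerStep hp]
  exact hp.evolve_mono δ (densityMeasure_cut_le _ _) _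

theorem iterate_lowerStep_le_iterate_upperStep (hp : IsJumpDensity p ξ) (hδ : 0 < δ)
    (hv : IsDensity v) (k : ℕ) :
    MassTransportLE (densityMeasure ((lowerStep p δ)^[k] v))
      (densityMeasure ((upperStep p δ)^[k] v)) := by
  induction k with
  | zero => exact .of_le le_rfl
  | succ k ih =>
    rw [Function.iterate_succ_apply', Function.iterate_succ_apply']
    have h1 := hv.iterate_lowerStep hp hδ k
    -- The intermediate term is an upper step applied to the k-th lower iterate.
    exact (lowerStep_le_upperStep hp hδ h1).trans
      (upperStep_mono hp hδ h1 (hv.iterate_upperStep hp hδ k) ih)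

theorem iterate_lowerStep_le_evolve (hp : IsJumpDensity p ξ) (hδ : 0 < δ) (hv : IsDensity v)
    (k : ℕ) : densityMeasure ((lowerStep p δ)^[k] v) ≤ evolve p (k * δ) (densityMeasure v) := by
  have := hv.sfinite
  induction k with
  | zero => simp [evolve_zero]
  | succ k ih =>
    rw [Function.iterate_succ_apply', (hv.iterate_lowerStep hp hδ k).densityMeasure_lowerStep hp,
      Nat.cast_succ, add_one_mul, ← hp.evolve_evolve (by positivity) hδ.le]
    exact hp.evolve_mono δ ((densityMeasure_cut_le _ _).trans ih)

theorem iterate_upperStep_le_evolve (hp : IsJumpDensity p ξ) (hδ : 0 < δ) (hv : IsDensity v)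
    (k : ℕ) : densityMeasure ((upperStep p δ)^[k] v) ≤ evolve p (k * δ) (densityMeasure v) := by
  have := hv.sfinite
  induction k with
  | zero => simp [evolve_zero]
  | succ k ih =>
    have h := hv.iterate_upperStep hp hδ k
    rw [Function.iterate_succ_apply', Nat.cast_succ, add_one_mul,
      ← hp.evolve_evolve (by positivity) hδ.le]
    refine (densityMeasure_cut_le _ _).trans ?_
    rw [hp.densityMeasure_freeEvolution_eq_evolve δ h.integrable h.nonneg]
    exact hp.evolve_mono δ ih

/-! ### Refinement of the time step -/

/-- Omitting all the cuts only increases the measure, and the mass stays one; the single large step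
is the minimum of these two bounds. -/
theorem upperStep_refine (hp : IsJumpDensity p ξ) (hδ : 0 < δ) (hw : IsDensity w) {m : ℕ}
    (hm : 0 < m) :
    MassTransportLE (densityMeasure ((upperStep p δ)^[m] w))
      (densityMeasure (upperStep p (m * δ) w)) := by
  intro r
  rw [hw.upperStep_Ici hp (by positivity)]
  exact le_min (iterate_upperStep_le_evolve hp hδ hw m _)
    ((hw.iterate_upperStep hp hδ m).densityMeasure_Ici_le_one r)

/-- After the large cut, the free evolution needs no further cutting: until the last small cut its
mass is at most e^{-δ}, so it stays below the small-step iterates even after each of them is cut. -/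
theorem lowerStep_refine (hp : IsJumpDensity p ξ) (hδ : 0 < δ) (hw : IsDensity w) {m : ℕ}
    (hm : 0 < m) :
    MassTransportLE (densityMeasure (lowerStep p (m * δ) w))
      (densityMeasure ((lowerStep p δ)^[m] w)) := by
  have hmδ : 0 < m * δ := by positivity
  have : IsFiniteMeasure (densityMeasure (cutMinus (m * δ) w)) := hw.isFiniteMeasure_cut _
  rw [hw.densityMeasure_lowerStep hp]
  have key : ∀ j : ℕ, j ≤ m → MassTransportLE
      (evolve p (j * δ) (densityMeasure (cutMinus (m * δ) w)))
      (densityMeasure ((lowerStep p δ)^[j] w)) := by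
    intro j
    induction j with
    | zero =>
      intro _
      rw [Nat.cast_zero, zero_mul, evolve_zero]
      exact .of_le (densityMeasure_cut_le _ _)
    | succ j ih =>
      intro hj
      have hL := hw.iterate_lowerStep hp hδ j
      have : IsFiniteMeasure (densityMeasure (cutMinus δ ((lowerStep p δ)^[j] w))) :=
        hL.isFiniteMeasure_cut _
      have := hp.isFiniteMeasure_evolve (j * δ) (densityMeasure (cutMinus (m * δ) w))
      rw [Function.iterate_succ_apply', hL.densityMeasure_lowerStep hp, Nat.cast_succ,
        add_one_mul, ← hp.evolve_evolve (by positivity) hδ.le]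
      refine hp.evolve_massTransportLE δ fun r => ?_
      rw [hL.cutMinus_Ici hδ]
      refine le_min (ih (Nat.le_of_succ_le hj) r) ?_
      refine (measure_mono (subset_univ _)).trans ?_
      rw [hp.evolve_univ, cutMinus, densityMeasure_apply_univ (integrable_cut _ hw.integrable)
        (cut_nonneg _ hw.nonneg),
        integral_cut hw.integrable (Real.exp_pos _) (hw.exp_neg_lt hmδ),
        ← ENNReal.ofReal_mul (Real.exp_pos _).le, ← Real.exp_add]
      -- The mass after j small steps is e^{jδ} e^{-mδ}, at most e^{-δ} because j + 1 ≤ m.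
      refine ENNReal.ofReal_le_ofReal (Real.exp_le_exp.2 ?_)
      have : ((j + 1 : ℕ) : ℝ) ≤ m := Nat.cast_le.2 hj
      push_cast at this
      nlinarith
  exact key m le_rfl

theorem iterate_lowerStep_refine (hp : IsJumpDensity p ξ) (hδ : 0 < δ) (hv : IsDensity v) {m : ℕ}
    (hm : 0 < m) (k : ℕ) :
    MassTransportLE (densityMeasure ((lowerStep p (m * δ))^[k] v))
      (densityMeasure ((lowerStep p δ)^[m * k] v)) := by
  have hmδ : 0 < m * δ := by positivity
  rw [Function.iterate_mul]
  induction k with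
  | zero => exact .of_le le_rfl
  | succ k ih =>
    have h1 := hv.iterate_lowerStep hp hmδ k
    have h2 := hv.iterate_lowerStep hp hδ (m * k)
    rw [Function.iterate_mul] at h2
    rw [Function.iterate_succ_apply', Function.iterate_succ_apply']
    exact (lowerStep_mono hp hmδ h1 h2 ih).trans (lowerStep_refine hp hδ h2 hm)

theorem iterate_upperStep_refine (hp : IsJumpDensity p ξ) (hδ : 0 < δ) (hv : IsDensity v) {m : ℕ}
    (hm : 0 < m) (k : ℕ) :
    MassTransportLE (densityMeasure ((upperStep p δ)^[m * k] v))
      (densityMeasure ((upperStep p (m * δ))^[k] v)) := by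
  have hmδ : 0 < m * δ := by positivity
  rw [Function.iterate_mul]
  induction k with
  | zero => exact .of_le le_rfl
  | succ k ih =>
    have h1 := hv.iterate_upperStep hp hmδ k
    have h2 := hv.iterate_upperStep hp hδ (m * k)
    rw [Function.iterate_mul] at h2
    rw [Function.iterate_succ_apply', Function.iterate_succ_apply']
    exact (upperStep_refine hp hδ h2 hm).trans (upperStep_mono hp hmδ h2 h1 ih)

/-! ### The distance between the barriers -/

theorem integral_abs_upperStep_sub_le (hp : IsJumpDensity p ξ) (hδ : 0 < δ) (hv : IsDensity v)
    (hw : IsDensity w) :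
    ∫ x, |upperStep p δ v x - upperStep p δ w x| ≤ Real.exp δ * ∫ x, |v x - w x| :=
  (integral_abs_cut_sub_le (hp.integrable_freeEvolution δ hv.integrable)
    (hp.integrable_freeEvolution δ hw.integrable) (freeEvolution_nonneg p δ hv.nonneg)
    (freeEvolution_nonneg p δ hw.nonneg)
    (by rw [hp.integral_freeEvolution δ hv.integrable, hp.integral_freeEvolution δ hw.integrable,
      hv.integral_eq_one, hw.integral_eq_one]) one_pos
    (hv.one_lt_integral_freeEvolution hp hδ)).trans
    (hp.integral_abs_freeEvolution_sub_le δ hv.integrable hw.integrable)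

theorem integral_abs_iterate_upperStep_sub_le (hp : IsJumpDensity p ξ) (hδ : 0 < δ)
    (hv : IsDensity v) (hw : IsDensity w) (k : ℕ) :
    ∫ x, |(upperStep p δ)^[k] v x - (upperStep p δ)^[k] w x| ≤
      Real.exp (k * δ) * ∫ x, |v x - w x| := by
  induction k with
  | zero => simp
  | succ k ih =>
    simp only [Function.iterate_succ_apply']
    refine (integral_abs_upperStep_sub_le hp hδ (hv.iterate_upperStep hp hδ k)
      (hw.iterate_upperStep hp hδ k)).trans ?_
    rw [Nat.cast_succ, add_one_mul, add_comm, Real.exp_add, mul_assoc]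
    exact mul_le_mul_of_nonneg_left ih (Real.exp_pos δ).le

/-- The cut of a density, normalized to have mass one. -/
noncomputable def normalizedCut (δ : ℝ) (w : ℝ → ℝ) : ℝ → ℝ :=
  fun x => Real.exp δ * cutMinus δ w x

theorem cutPlus_exp_mul (δ : ℝ) (w : ℝ → ℝ) :
    cutPlus (fun x => Real.exp δ * w x) = normalizedCut δ w := by
  have := cut_const_mul (Real.exp_ne_zero δ) (Real.exp (-δ)) w
  rwa [← Real.exp_add, add_neg_cancel, Real.exp_zero] at this

/-- Both sides are C⁺ T* (e^δ C⁻ w): the factor e^δ passes through T* by linearity and turns a cut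
to mass e^{-δ} into a cut to mass one. This intertwining carries the L¹ estimate. -/
theorem normalizedCut_lowerStep (p : ℝ → ℝ → ℝ) (δ : ℝ) (w : ℝ → ℝ) :
    normalizedCut δ (lowerStep p δ w) = upperStep p δ (normalizedCut δ w) := by
  rw [← cutPlus_exp_mul]
  exact congrArg cutPlus (freeEvolution_const_mul p δ _ _).symm

theorem IsDensity.normalizedCut (hw : IsDensity w) (hδ : 0 < δ) :
    IsDensity (normalizedCut δ w) where
  nonneg x := mul_nonneg (Real.exp_pos δ).le (cut_nonneg _ hw.nonneg x)
  integrable := (integrable_cut _ hw.integrable).const_mul _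
  integral_eq_one := by
    simp only [FreeBoundary.normalizedCut]
    rw [integral_const_mul, cutMinus,
      integral_cut hw.integrable (Real.exp_pos _) (hw.exp_neg_lt hδ), ← Real.exp_add,
      add_neg_cancel, Real.exp_zero]

/-- The mass removed on the left, 1 - e^{-δ}, is put back on the right by normalization, so the
distance is 2(1 - e^{-δ}). -/
theorem IsDensity.integral_abs_normalizedCut_sub_le (hw : IsDensity w) (hδ : 0 < δ) :
    ∫ x, |FreeBoundary.normalizedCut δ w x - w x| ≤ 2 * δ := by
  have hc : Integrable (cutMinus δ w) := integrable_cut _ hw.integrable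
  have hI : ∫ x, cutMinus δ w x = Real.exp (-δ) :=
    integral_cut hw.integrable (Real.exp_pos _) (hw.exp_neg_lt hδ)
  have h1 : 1 ≤ Real.exp δ := Real.one_le_exp hδ.le
  have h2 : ∀ x, |FreeBoundary.normalizedCut δ w x - w x| =
      (Real.exp δ - 2) * cutMinus δ w x + w x := by
    intro x
    rw [FreeBoundary.normalizedCut, cutMinus, cut]
    by_cases h : x ∈ Ici (cutPoint (Real.exp (-δ)) w)
    · rw [indicator_of_mem h, abs_of_nonneg (by nlinarith [hw.nonneg x])]
      ring
    · rw [indicator_of_notMem h, abs_of_nonpos (by linarith [hw.nonneg x])]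
      ring
  simp_rw [h2]
  rw [integral_add (hc.const_mul _) hw.integrable, integral_const_mul, hI, hw.integral_eq_one,
    sub_mul, ← Real.exp_add, add_neg_cancel, Real.exp_zero]
  linarith [Real.add_one_le_exp (-δ)]

theorem integral_abs_iterate_lowerStep_sub_iterate_upperStep_le (hp : IsJumpDensity p ξ)
    (hδ : 0 < δ) (hv : IsDensity v) (k : ℕ) :
    ∫ x, |(lowerStep p δ)^[k] v x - (upperStep p δ)^[k] v x| ≤ 4 * Real.exp (k * δ) * δ := by
  have hL := hv.iterate_lowerStep hp hδ k
  have hU := hv.iterate_upperStep hp hδ k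
  have hcomm : normalizedCut δ ((lowerStep p δ)^[k] v) =
      (upperStep p δ)^[k] (normalizedCut δ v) :=
    Function.Semiconj.iterate_right (normalizedCut_lowerStep p δ) k v
  have hA := hL.normalizedCut hδ
  have b1 := hL.integral_abs_normalizedCut_sub_le hδ
  have b2 := (integral_abs_iterate_upperStep_sub_le hp hδ (hv.normalizedCut hδ) hv k).trans
    (mul_le_mul_of_nonneg_left (hv.integral_abs_normalizedCut_sub_le hδ) (Real.exp_pos _).le)
  rw [← hcomm] at b2
  have i1 : Integrable fun x => |normalizedCut δ ((lowerStep p δ)^[k] v) x -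
      (lowerStep p δ)^[k] v x| := (hA.integrable.sub hL.integrable).abs
  have i2 : Integrable fun x => |normalizedCut δ ((lowerStep p δ)^[k] v) x -
      (upperStep p δ)^[k] v x| := (hA.integrable.sub hU.integrable).abs
  have b3 : ∫ x, |(lowerStep p δ)^[k] v x - (upperStep p δ)^[k] v x| ≤
      (∫ x, |normalizedCut δ ((lowerStep p δ)^[k] v) x - (lowerStep p δ)^[k] v x|) +
      ∫ x, |normalizedCut δ ((lowerStep p δ)^[k] v) x - (upperStep p δ)^[k] v x| := by
    rw [← integral_add i1 i2]
    refine integral_mono (hL.integrable.sub hU.integrable).abs (i1.add i2) fun x => ?_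
    have := abs_sub_le ((lowerStep p δ)^[k] v x) (normalizedCut δ ((lowerStep p δ)^[k] v) x)
      ((upperStep p δ)^[k] v x)
    rwa [abs_sub_comm ((lowerStep p δ)^[k] v x) (normalizedCut _ _ x)] at this
  have h1 : 1 ≤ Real.exp (k * δ) := Real.one_le_exp (by positivity)
  nlinarith

/-! ### The separating element -/

/-- A tail function whose increments are dominated by those of an integrable function is the tail
function of a density. -/
theorem exists_isDensity_of_tail {F h : ℝ → ℝ} (hF : Antitone F) (hh : Integrable h)
    (h0 : ∀ x, 0 ≤ h x) (hFh : ∀ a b, a ≤ b → F a - F b ≤ ∫ x in a..b, h x)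
    (hbot : Filter.Tendsto F Filter.atBot (nhds 1))
    (htop : Filter.Tendsto F Filter.atTop (nhds 0)) :
    ∃ u, IsDensity u ∧ ∀ r, densityMeasure u (Ici r) = ENNReal.ofReal (F r) := by
  set H : ℝ → ℝ := fun x => ∫ t in (0 : ℝ)..x, h t with hHdef
  have hH : Continuous H := hh.continuous_primitive 0
  have hint (a b : ℝ) : ∫ x in a..b, h x = H b - H a :=
    (intervalIntegral.integral_interval_sub_left hh.intervalIntegrable
      hh.intervalIntegrable).symm
  have hFc : Continuous F := by
    rw [continuous_iff_continuousAt]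
    intro x
    have hz : Filter.Tendsto (fun y => |H y - H x|) (nhds x) (nhds 0) := by
      have : Continuous fun y => |H y - H x| := (hH.sub continuous_const).abs
      simpa using this.tendsto x
    refine tendsto_iff_dist_tendsto_zero.2 (squeeze_zero (fun _ => dist_nonneg) (fun y => ?_) hz)
    rw [Real.dist_eq]
    rcases le_total x y with hxy | hxy
    · have h1 := hFh x y hxy
      rw [hint] at h1
      rw [abs_of_nonpos (sub_nonpos.2 (hF hxy))]
      exact (by linarith : -(F y - F x) ≤ H y - H x).trans (le_abs_self _)
    · have h1 := hFh y x hxy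
      rw [hint] at h1
      rw [abs_of_nonneg (sub_nonneg.2 (hF hxy)), abs_sub_comm]
      exact h1.trans (le_abs_self _)
  let G : StieltjesFunction ℝ :=
    { toFun := fun x => 1 - F x
      mono' := fun x y hxy => sub_le_sub_left (hF hxy) 1
      right_continuous' := fun x => (continuous_const.sub hFc).continuousWithinAt }
  -- The increment bound says exactly that the complement of `G` in the primitive of h is monotone.
  -- Hence `G.measure` is dominated by h dx and has a density.
  let D : StieltjesFunction ℝ :=
    { toFun := fun x => H x - (1 - F x)
      mono' := fun x y hxy => by
        have := hFh x y hxy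
        rw [hint] at this
        dsimp only
        linarith
      right_continuous' := fun x => (hH.sub (continuous_const.sub hFc)).continuousWithinAt }
  have hGbot : Filter.Tendsto G Filter.atBot (nhds 0) := by
    simpa using (tendsto_const_nhds (x := (1 : ℝ))).sub hbot
  have hGtop : Filter.Tendsto G Filter.atTop (nhds 1) := by
    simpa using (tendsto_const_nhds (x := (1 : ℝ))).sub htop
  have hGp : IsProbabilityMeasure G.measure := G.isProbabilityMeasure hGbot hGtop
  have hsum : (G + D).measure = densityMeasure h := by
    refine Measure.ext_of_Ioc _ _ fun a b hab => ?_
    rw [StieltjesFunction.measure_Ioc, densityMeasure, withDensity_apply _ measurableSet_Ioc,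
      ← ofReal_integral_eq_lintegral_ofReal hh.integrableOn (ae_of_all _ h0),
      ← intervalIntegral.integral_of_le hab.le, hint]
    congr 1
    simp only [StieltjesFunction.add_apply]
    change 1 - F b + (H b - (1 - F b)) - (1 - F a + (H a - (1 - F a))) = _
    ring
  have hac : G.measure ≪ volume := by
    refine Measure.AbsolutelyContinuous.trans (Measure.absolutelyContinuous_of_le ?_)
      (withDensity_absolutelyContinuous volume fun r => ENNReal.ofReal (h r))
    rw [← densityMeasure, ← hsum, StieltjesFunction.measure_add]
    exact Measure.le_add_right le_rfl
  have hu : densityMeasure (fun x => (G.measure.rnDeriv volume x).toReal) = G.measure := by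
    conv_rhs => rw [← Measure.withDensity_rnDeriv_eq _ _ hac]
    refine withDensity_congr_ae ?_
    filter_upwards [Measure.rnDeriv_lt_top G.measure volume] with x hx
    exact ENNReal.ofReal_toReal hx.ne
  have hi : Integrable fun x => (G.measure.rnDeriv volume x).toReal :=
    Measure.integrable_toReal_rnDeriv
  refine ⟨_, ⟨fun x => ENNReal.toReal_nonneg, hi, ?_⟩, fun r => ?_⟩
  · have := densityMeasure_apply_univ hi fun x => ENNReal.toReal_nonneg
    rw [hu, measure_univ] at this
    exact (ENNReal.ofReal_eq_one.1 this.symm)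
  · rw [hu, StieltjesFunction.measure_Ici _ hGtop]
    congr 1
    have : Function.leftLim G r = 1 - F r :=
      ContinuousWithinAt.leftLim_eq (continuous_const.sub hFc).continuousWithinAt
    rw [this]
    ring

variable {t : ℝ}

/-- Both barriers are compared at the common step t/(ab). -/
theorem iterate_lowerStep_div_le_iterate_upperStep_div (hp : IsJumpDensity p ξ) (ht : 0 < t)
    (hv : IsDensity v) {a b : ℕ} (ha : 0 < a) (hb : 0 < b) :
    MassTransportLE (densityMeasure ((lowerStep p (t / a))^[a] v))
      (densityMeasure ((upperStep p (t / b))^[b] v)) := by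
  have ha' : (0 : ℝ) < a := Nat.cast_pos.2 ha
  have hb' : (0 : ℝ) < b := Nat.cast_pos.2 hb
  have hη : 0 < t / (a * b) := by positivity
  have h1 := iterate_lowerStep_refine hp hη hv hb a
  have h2 := iterate_upperStep_refine hp hη hv ha b
  rw [show b * (t / (a * b)) = t / a by field_simp] at h1
  rw [show a * (t / (a * b)) = t / b by field_simp] at h2
  rw [mul_comm b a] at h1
  exact (h1.trans (iterate_lowerStep_le_iterate_upperStep hp hη hv (a * b))).trans h2

theorem tendsto_densityMeasure_Ici_atTop {h : ℝ → ℝ} (hh : Integrable h) (h0 : ∀ x, 0 ≤ h x) :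
    Filter.Tendsto (fun r => densityMeasure h (Ici r)) Filter.atTop (nhds 0) := by
  simp_rw [densityMeasure_Ici hh h0]
  rw [← ENNReal.ofReal_zero]
  exact ENNReal.tendsto_ofReal (tendsto_integral_Ici_zero Filter.tendsto_id)

theorem IsDensity.tendsto_densityMeasure_Ici_atBot (hv : IsDensity v) :
    Filter.Tendsto (fun r => densityMeasure v (Ici r)) Filter.atBot (nhds 1) := by
  simp_rw [densityMeasure_Ici hv.integrable hv.nonneg]
  rw [← ENNReal.ofReal_one, ← hv.integral_eq_one]
  exact ENNReal.tendsto_ofReal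
    ((aecover_Ici Filter.tendsto_id).integral_tendsto_of_countably_generated hv.integrable)

theorem exists_isDensity_between (hp : IsJumpDensity p ξ) (ht : 0 < t) (hv : IsDensity v) :
    ∃ u, IsDensity u ∧ ∀ k : ℕ, 0 < k →
      MassTransportLE (densityMeasure ((lowerStep p (t / k))^[k] v)) (densityMeasure u) ∧
      MassTransportLE (densityMeasure u) (densityMeasure ((upperStep p (t / k))^[k] v)) := by
  -- The index is shifted so that the number of steps k + 1 is never zero.
  let l : ℕ → Measure ℝ := fun k => densityMeasure ((lowerStep p (t / (k + 1 : ℕ)))^[k + 1] v)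
  have hl (k : ℕ) : IsDensity ((lowerStep p (t / (k + 1 : ℕ)))^[k + 1] v) :=
    hv.iterate_lowerStep hp (by positivity) _
  set Φ : ℝ → ℝ≥0∞ := fun r => ⨆ k, l k (Ici r) with hΦ
  set h := freeEvolution p t v
  have hh : Integrable h := hp.integrable_freeEvolution t hv.integrable
  have h0 : ∀ x, 0 ≤ h x := freeEvolution_nonneg p t hv.nonneg
  -- A majorant independent of k: it gives the supremum of the tails both its decay at +∞ and its
  -- increment bound.
  have hlh (k : ℕ) : l k ≤ densityMeasure h := by
    have := iterate_lowerStep_le_evolve hp (δ := t / (k + 1 : ℕ)) (by positivity) hv (k + 1)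
    rw [mul_div_cancel₀ _ (by positivity)] at this
    rwa [hp.densityMeasure_freeEvolution_eq_evolve t hv.integrable hv.nonneg]
  have hΦ1 (r : ℝ) : Φ r ≤ 1 := iSup_le fun k => (hl k).densityMeasure_Ici_le_one r
  have hΦtop (r : ℝ) : Φ r ≠ (⊤ : ℝ≥0∞) := ((hΦ1 r).trans_lt ENNReal.one_lt_top).ne
  have hΦle (r : ℝ) : Φ r ≤ densityMeasure h (Ici r) := iSup_le fun k => hlh k _
  -- No mass escapes to -∞, because the one-step lower barrier alone already has total mass one.
  have hΦbot : Filter.Tendsto Φ Filter.atBot (nhds 1) :=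
    tendsto_of_tendsto_of_tendsto_of_le_of_le (hl 0).tendsto_densityMeasure_Ici_atBot
      tendsto_const_nhds (fun r => le_iSup (fun k => l k (Ici r)) 0) hΦ1
  have hΦzero : Filter.Tendsto Φ Filter.atTop (nhds 0) :=
    tendsto_of_tendsto_of_tendsto_of_le_of_le tendsto_const_nhds
      (tendsto_densityMeasure_Ici_atTop hh h0) (fun r => zero_le) hΦle
  have hanti : Antitone fun r => (Φ r).toReal := fun a b hab =>
    ENNReal.toReal_mono (hΦtop a) (iSup_mono fun k => measure_mono (Ici_subset_Ici.2 hab))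
  have hinc (a b : ℝ) (hab : a ≤ b) : (Φ a).toReal - (Φ b).toReal ≤ ∫ x in a..b, h x := by
    have h1 : Φ a ≤ ENNReal.ofReal (∫ x in a..b, h x) + Φ b := by
      refine iSup_le fun k => ?_
      rw [← Ico_union_Ici_eq_Ici hab]
      refine (measure_union_le _ _).trans (add_le_add ?_ (le_iSup (fun k => l k (Ici b)) k))
      refine (hlh k _).trans ?_
      rw [densityMeasure, withDensity_apply _ measurableSet_Ico,
        ← ofReal_integral_eq_lintegral_ofReal hh.integrableOn (ae_of_all _ h0),
        intervalIntegral.integral_of_le hab, integral_Ico_eq_integral_Ioo,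
        integral_Ioc_eq_integral_Ioo]
    have h2 : 0 ≤ ∫ x in a..b, h x := intervalIntegral.integral_nonneg hab fun x _ => h0 x
    have h3 := ENNReal.toReal_mono (ENNReal.add_ne_top.2 ⟨ENNReal.ofReal_ne_top, hΦtop b⟩) h1
    rw [ENNReal.toReal_add ENNReal.ofReal_ne_top (hΦtop b), ENNReal.toReal_ofReal h2] at h3
    linarith
  obtain ⟨u, hu, hur⟩ := exists_isDensity_of_tail hanti hh h0 hinc
    (by simpa [Function.comp_def] using (ENNReal.tendsto_toReal ENNReal.one_ne_top).comp hΦbot)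
    (by simpa [Function.comp_def] using (ENNReal.tendsto_toReal ENNReal.zero_ne_top).comp hΦzero)
  refine ⟨u, hu, fun k hk => ⟨fun r => ?_, fun r => ?_⟩⟩
  · rw [hur, ENNReal.ofReal_toReal (hΦtop r)]
    obtain ⟨j, rfl⟩ := Nat.exists_eq_succ_of_ne_zero hk.ne'
    exact le_iSup (fun k => l k (Ici r)) j
  · rw [hur, ENNReal.ofReal_toReal (hΦtop r)]
    exact iSup_le fun j =>
      iterate_lowerStep_div_le_iterate_upperStep_div hp ht hv j.succ_pos hk r

/-! ### Uniqueness -/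

theorem ae_eq_of_densityMeasure_eq {f g : ℝ → ℝ} (hf : Integrable f) (hg : Integrable g)
    (f0 : ∀ x, 0 ≤ f x) (g0 : ∀ x, 0 ≤ g x) (h : densityMeasure f = densityMeasure g) :
    f =ᵐ[volume] g := by
  have := (withDensity_eq_iff hf.aestronglyMeasurable.aemeasurable.ennreal_ofReal
    hg.aestronglyMeasurable.aemeasurable.ennreal_ofReal hf.lintegral_lt_top.ne).1 h
  filter_upwards [this] with x hx
  exact (ENNReal.ofReal_eq_ofReal_iff (f0 x) (g0 x)).1 hx

/-- For each k both tails at r lie between the same two barrier tails, whose gap is at most the L¹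
distance 4 e^t t/k. -/
theorem ae_eq_of_between (hp : IsJumpDensity p ξ) (ht : 0 < t) (hv : IsDensity v) {f g : ℝ → ℝ}
    (hf : Integrable f) (hg : Integrable g) (f0 : ∀ x, 0 ≤ f x) (g0 : ∀ x, 0 ≤ g x)
    (hf' : ∀ k : ℕ, 0 < k →
      MassTransportLE (densityMeasure ((lowerStep p (t / k))^[k] v)) (densityMeasure f) ∧
      MassTransportLE (densityMeasure f) (densityMeasure ((upperStep p (t / k))^[k] v)))
    (hg' : ∀ k : ℕ, 0 < k →
      MassTransportLE (densityMeasure ((lowerStep p (t / k))^[k] v)) (densityMeasure g) ∧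
      MassTransportLE (densityMeasure g) (densityMeasure ((upperStep p (t / k))^[k] v))) :
    f =ᵐ[volume] g := by
  have := isFiniteMeasure_densityMeasure hf
  have := isFiniteMeasure_densityMeasure hg
  refine ae_eq_of_densityMeasure_eq hf hg f0 g0 (Measure.ext_of_Ici _ _ fun r => ?_)
  rw [densityMeasure_Ici hf f0, densityMeasure_Ici hg g0]
  congr 1
  have tail_le {a b : ℝ → ℝ} (ha : Integrable a) (hb : Integrable b) (a0 : ∀ x, 0 ≤ a x)
      (b0 : ∀ x, 0 ≤ b x) (hab : MassTransportLE (densityMeasure a) (densityMeasure b)) :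
      ∫ x in Ici r, a x ≤ ∫ x in Ici r, b x := by
    have := hab r
    rwa [densityMeasure_Ici ha a0, densityMeasure_Ici hb b0,
      ENNReal.ofReal_le_ofReal_iff (integral_nonneg b0)] at this
  have hbound (k : ℕ) : |(∫ x in Ici r, f x) - ∫ x in Ici r, g x| ≤
      4 * Real.exp t * t * (1 / ((k : ℝ) + 1)) := by
    have hδ : 0 < t / (k + 1 : ℕ) := by positivity
    have hL := hv.iterate_lowerStep hp hδ (k + 1)
    have hU := hv.iterate_upperStep hp hδ (k + 1)
    have f1 := tail_le hL.integrable hf hL.nonneg f0 (hf' (k + 1) k.succ_pos).1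
    have f2 := tail_le hf hU.integrable f0 hU.nonneg (hf' (k + 1) k.succ_pos).2
    have g1 := tail_le hL.integrable hg hL.nonneg g0 (hg' (k + 1) k.succ_pos).1
    have g2 := tail_le hg hU.integrable g0 hU.nonneg (hg' (k + 1) k.succ_pos).2
    have hd := integral_abs_iterate_lowerStep_sub_iterate_upperStep_le hp hδ hv (k + 1)
    rw [mul_div_cancel₀ _ (by positivity)] at hd
    have hLU : Integrable fun x => |(lowerStep p (t / (k + 1 : ℕ)))^[k + 1] v x -
        (upperStep p (t / (k + 1 : ℕ)))^[k + 1] v x| := (hL.integrable.sub hU.integrable).abs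
    have hs : (∫ x in Ici r, (upperStep p (t / (k + 1 : ℕ)))^[k + 1] v x) -
        ∫ x in Ici r, (lowerStep p (t / (k + 1 : ℕ)))^[k + 1] v x ≤
        ∫ x, |(lowerStep p (t / (k + 1 : ℕ)))^[k + 1] v x -
          (upperStep p (t / (k + 1 : ℕ)))^[k + 1] v x| := by
      rw [← integral_sub hU.integrable.integrableOn hL.integrable.integrableOn]
      refine (integral_mono (hU.integrable.sub hL.integrable).integrableOn hLU.integrableOn
        fun x => ?_).trans (setIntegral_le_integral hLU (ae_of_all _ fun x => abs_nonneg _))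
      dsimp only
      rw [abs_sub_comm]
      exact le_abs_self _
    have he : 4 * Real.exp t * (t / (k + 1 : ℕ)) = 4 * Real.exp t * t * (1 / ((k : ℝ) + 1)) := by
      push_cast
      ring
    rw [he] at hd
    rw [abs_le]
    constructor <;> linarith
  have hlim : Filter.Tendsto (fun k : ℕ => 4 * Real.exp t * t * (1 / ((k : ℝ) + 1)))
      Filter.atTop (nhds 0) := by
    simpa using tendsto_one_div_add_atTop_nhds_zero_nat.const_mul (4 * Real.exp t * t)
  have := ge_of_tendsto' hlim hbound
  exact sub_eq_zero.1 (abs_eq_zero.1 (le_antisymm this (abs_nonneg _)))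

/-- Parametrizing by the time t and the number of steps k, with δ = t/k, decouples different times:
existence and uniqueness can be treated for each t separately. -/
theorem separatesBarriers_iff {u : ℝ → ℝ → ℝ} :
    SeparatesBarriers p v u ↔ ∀ t : ℝ, 0 < t → ∀ k : ℕ, 0 < k →
      MassTransportLE (densityMeasure ((lowerStep p (t / k))^[k] v))
        (densityMeasure fun r => u r t) ∧
      MassTransportLE (densityMeasure fun r => u r t)
        (densityMeasure ((upperStep p (t / k))^[k] v)) := by
  constructor
  · intro h t ht k hk
    have hk' : (0 : ℝ) < k := Nat.cast_pos.2 hk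
    have hδ : 0 < t / k := by positivity
    have := h (t / k) hδ k hk
    rwa [lowerBarrier_natCast_mul p v hδ, upperBarrier_natCast_mul p v hδ,
      mul_div_cancel₀ _ hk'.ne'] at this
  · intro h δ hδ k hk
    have hk' : (0 : ℝ) < k := Nat.cast_pos.2 hk
    have := h (k * δ) (by positivity) k hk
    rwa [mul_div_cancel_left₀ _ hk'.ne', ← lowerBarrier_natCast_mul p v hδ,
      ← upperBarrier_natCast_mul p v hδ] at this

end FreeBoundary

theorem mainTheorem3 :
    ∃ c : ℝ, ∀ (p : ℝ → ℝ → ℝ) (ξ : ℝ), FreeBoundary.IsJumpDensity p ξ →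
      ∀ v : ℝ → ℝ, FreeBoundary.IsDensity v →
      -- at the times `t = kδ` the barriers are probability densities
      (∀ δ : ℝ, 0 < δ → ∀ k : ℕ, 1 ≤ k →
        FreeBoundary.IsDensity (FreeBoundary.lowerBarrier p v δ (k * δ)) ∧
        FreeBoundary.IsDensity (FreeBoundary.upperBarrier p v δ (k * δ))) ∧
      -- the lower barrier is below the upper barrier
      (∀ δ : ℝ, 0 < δ → ∀ k : ℕ, 1 ≤ k →
        FreeBoundary.MassTransportLE
          (FreeBoundary.densityMeasure (FreeBoundary.lowerBarrier p v δ (k * δ)))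
          (FreeBoundary.densityMeasure (FreeBoundary.upperBarrier p v δ (k * δ)))) ∧
      -- monotonicity when `δ` is halved
      (∀ δ : ℝ, 0 < δ → ∀ k : ℕ, 1 ≤ k →
        FreeBoundary.MassTransportLE
          (FreeBoundary.densityMeasure (FreeBoundary.lowerBarrier p v δ (k * δ)))
          (FreeBoundary.densityMeasure (FreeBoundary.lowerBarrier p v (δ / 2) (k * δ))) ∧
        FreeBoundary.MassTransportLE
          (FreeBoundary.densityMeasure (FreeBoundary.upperBarrier p v (δ / 2) (k * δ)))
          (FreeBoundary.densityMeasure (FreeBoundary.upperBarrier p v δ (k * δ)))) ∧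
      -- existence and uniqueness (as a density) of the separating element
      (∃ u : ℝ → ℝ → ℝ,
        ((∀ t : ℝ, 0 < t → FreeBoundary.IsDensity (fun r => u r t)) ∧
          FreeBoundary.SeparatesBarriers p v u) ∧
        ∀ w : ℝ → ℝ → ℝ,
          (∀ t : ℝ, 0 < t → MeasureTheory.Integrable (fun r => w r t) ∧ ∀ r, 0 ≤ w r t) →
          FreeBoundary.SeparatesBarriers p v w →
          ∀ t : ℝ, 0 < t →
            (fun r => w r t) =ᵐ[MeasureTheory.volume] (fun r => u r t)) ∧
      -- the barriers are close in `L¹`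
      (∀ T : ℝ, 0 < T → ∀ (n : ℕ) (δ : ℝ), δ = T / 2 ^ n →
        ∫ r, |FreeBoundary.lowerBarrier p v δ (2 ^ n * δ) r -
            FreeBoundary.upperBarrier p v δ (2 ^ n * δ) r| ≤ c * Real.exp T * δ) := by
  refine ⟨4, fun p ξ hp v hv => ⟨fun δ hδ k _ => ?_, fun δ hδ k _ => ?_, fun δ hδ k _ => ?_,
    ?_, fun T hT n δ hTδ => ?_⟩⟩
  · rw [FreeBoundary.lowerBarrier_natCast_mul p v hδ, FreeBoundary.upperBarrier_natCast_mul p v hδ]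
    exact ⟨hv.iterate_lowerStep hp hδ k, hv.iterate_upperStep hp hδ k⟩
  · rw [FreeBoundary.lowerBarrier_natCast_mul p v hδ, FreeBoundary.upperBarrier_natCast_mul p v hδ]
    exact FreeBoundary.iterate_lowerStep_le_iterate_upperStep hp hδ hv k
  -- Halving δ is the refinement with m = 2.
  · have e1 : (k : ℝ) * δ = (2 * k : ℕ) * (δ / 2) := by push_cast; ring
    have e2 : ((2 : ℕ) : ℝ) * (δ / 2) = δ := by push_cast; ring
    have h1 := FreeBoundary.iterate_lowerStep_refine hp (half_pos hδ) hv two_pos k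
    have h2 := FreeBoundary.iterate_upperStep_refine hp (half_pos hδ) hv two_pos k
    rw [e2, ← FreeBoundary.lowerBarrier_natCast_mul p v hδ,
      ← FreeBoundary.lowerBarrier_natCast_mul p v (half_pos hδ), ← e1] at h1
    rw [e2, ← FreeBoundary.upperBarrier_natCast_mul p v hδ,
      ← FreeBoundary.upperBarrier_natCast_mul p v (half_pos hδ), ← e1] at h2
    exact ⟨h1, h2⟩
  · choose! u hu hub using fun (t : ℝ) (ht : 0 < t) =>
      FreeBoundary.exists_isDensity_between hp ht hv
    refine ⟨fun r t => u t r, ⟨hu, FreeBoundary.separatesBarriers_iff.2 hub⟩,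
      fun w hw hsep t ht => ?_⟩
    exact FreeBoundary.ae_eq_of_between hp ht hv (hw t ht).1 (hu t ht).integrable (hw t ht).2
      (hu t ht).nonneg (FreeBoundary.separatesBarriers_iff.1 hsep t ht) (hub t ht)
  · have hδ : 0 < δ := by rw [hTδ]; positivity
    have e : ((2 : ℝ) ^ n) = ((2 ^ n : ℕ) : ℝ) := by push_cast; rfl
    have eT : ((2 ^ n : ℕ) : ℝ) * δ = T := by
      rw [hTδ, ← e]
      field_simp
    have := FreeBoundary.integral_abs_iterate_lowerStep_sub_iterate_upperStep_le hp hδ hv (2 ^ n)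
    rw [eT, ← FreeBoundary.lowerBarrier_natCast_mul p v hδ,
      ← FreeBoundary.upperBarrier_natCast_mul p v hδ] at this
    rwa [e]
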